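/- Let $\mathcal A$ be a finite non-empty alphabet, and let $\varrho$ be a primitive substitution on $\mathcal A$: a map sending each letter to a finite word, whose substitution matrix $M$ (with $M_{ij}$ the number of letters $i$ in $\varrho(j)$) has a power $M^p$, $p\geqslant 1$, with all entries strictly positive. Let $\lambda$ be the Perron–Frobenius eigenvalue of $M$ (the inflation multiplier), and let $\ell=(\ell_i)_{i\in\mathcal A}$ be natural tile lengths, that is, a left eigenvector of $M$ for $\lambda$ with strictly positive entries. For $n\geqslant 1$, let $T^{(n)}_{ij}\subset\mathbb R$ be the set of left endpoints of the tiles of type $i$ in the patch $\varrho^n(j)$, where a letter $a$ is represented by an interval of length $\ell_a$ and the patch starts at $0$. Define the Fourier matrices $$B^{(n)}_{ij}(k)=\sum_{t\in T^{(n)}_{ij}}\mathrm e^{2\pi\mathrm i tk},\qquad B=B^{(1)}.$$ Fix any norm $\|\cdot\|$ on the complex $\mathcal A\times\mathcal A$ matrices and set, with values in $[-\infty,\infty]$, $\log 0=-\infty$ and $\log (0^{-1})=+\infty$, $$\chi^{B}(k)=\limsup_{n\to\infty}\tfrac1n\log\|B^{(n)}(k)\|,\qquad \chi_{\min}(k)=\log\sqrt\lambda+\liminf_{n\to\infty}\tfrac1n\log\big\|B(k)B(\lambda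 k)\cdots B(\lambda^{n-1}k)\big\|^{-1}.$$ Then $\chi_{\min}(k)\geqslant 0$ for Lebesgue-a.e. $k\in\mathbb R$, and $\chi^{B}(k)\leqslant\log\sqrt\lambda$ for Lebesgue-a.e. $k\in\mathbb R$. These two claims are equivalent: for every $k\in\mathbb R$, one has $\chi_{\min}(k)\geqslant0$ if and only if $\chi^{B}(k)\leqslant\log\sqrt\lambda$. -/

import Mathlib

open MeasureTheory Filter

noncomputable section

namespace Inflation

variable {A : Type*} [DecidableEq A]

/-- The substitution matrix of the rule `ϱ` (which maps each letter to a word):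
its entry `(i, j)` is the number of letters `i` in the word `ϱ j`. -/
def substMatrix (ϱ : A → List A) : Matrix A A ℝ :=
  Matrix.of fun i j => ((ϱ j).count i : ℝ)

/-- `ℓ` is a vector of natural tile lengths for `ϱ`, and `lam` is the inflation multiplier:
`ℓ` is a strictly positive left eigenvector of the substitution matrix, with eigenvalue `lam`.
Equivalently, the tile of type `j`, expanded by the factor `lam`, is tiled exactly by
the tiles in the word `ϱ j`. For a primitive `ϱ`, the Perron-Frobenius theorem says that such a
pair exists, that `lam` is the Perron-Frobenius eigenvalue, and that `ℓ` is unique up to a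
positive factor. -/
def IsNaturalLengths [Fintype A] (ϱ : A → List A) (lam : ℝ) (ℓ : A → ℝ) : Prop :=
  (∀ a, 0 < ℓ a) ∧ Matrix.vecMul ℓ (substMatrix ϱ) = lam • ℓ

/-- The powers of a substitution, `ϱ ^ (n + 1) = ϱ ∘ ϱ ^ n`, where `ϱ` acts on words by
concatenation. -/
def substPow (ϱ : A → List A) : ℕ → A → List A
  | 0 => fun a => [a]
  | n + 1 => fun a => (substPow ϱ n a).flatMap ϱ

/-- The displacement set `T i j`: the positions (left endpoints, relative to the left endpoint of
the patch) of the tiles of type `i` in the patch `ϱ j`, for tile lengths `ℓ`. The tile with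
index `p` starts where the first `p` tiles of the patch end. -/
def displacements (ϱ : A → List A) (ℓ : A → ℝ) (i j : A) : Finset ℝ :=
  ((Finset.range (ϱ j).length).filter fun p => (ϱ j)[p]? = some i).image
    fun p => (((ϱ j).take p).map ℓ).sum

/-- The Fourier matrix `B k`. -/
def fourierMatrix (ϱ : A → List A) (ℓ : A → ℝ) (k : ℝ) : Matrix A A ℂ :=
  Matrix.of fun i j =>
    ∑ t ∈ displacements ϱ ℓ i j, Complex.exp (2 * Real.pi * Complex.I * t * k)

variable [Fintype A]

/-- The maximal Lyapunov exponent of the Fourier matrix cocycle,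
`limsup (1 / n) log ‖B⁽ⁿ⁾ k‖`, where `B⁽ⁿ⁾` is the Fourier matrix of `ϱ ^ n` (with the same
tile lengths) and `N` is the norm in use. The value is in the extended reals,
with `log 0 = -∞`. -/
def chiB (N : Seminorm ℂ (Matrix A A ℂ)) (ϱ : A → List A) (ℓ : A → ℝ) (k : ℝ) : EReal :=
  limsup (fun n : ℕ => ((1 / (n : ℝ) : ℝ) : EReal) *
    ENNReal.log (ENNReal.ofReal (N (fourierMatrix (substPow ϱ n) ℓ k)))) atTop

/-- The product `B (k) B (lam k) ⋯ B (lam ^ (n - 1) k)`. -/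
def fourierProd (ϱ : A → List A) (lam : ℝ) (ℓ : A → ℝ) (n : ℕ) (k : ℝ) : Matrix A A ℂ :=
  ((List.range n).map fun m => fourierMatrix ϱ ℓ (lam ^ m * k)).prod

/-- The minimal Lyapunov exponent of the outward iteration,
`log √lam + liminf (1 / n) log (‖B (k) B (lam k) ⋯ B (lam ^ (n - 1) k)‖⁻¹)`,
in the extended reals, with `0⁻¹ = ∞` and `log ∞ = ∞`. -/
def chiMin (N : Seminorm ℂ (Matrix A A ℂ)) (ϱ : A → List A) (lam : ℝ) (ℓ : A → ℝ)
    (k : ℝ) : EReal :=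
  ((Real.log (Real.sqrt lam) : ℝ) : EReal) +
    liminf (fun n : ℕ => ((1 / (n : ℝ) : ℝ) : EReal) *
      ENNReal.log (ENNReal.ofReal (N (fourierProd ϱ lam ℓ n k)))⁻¹) atTop

end Inflation

end

/-!
Write `B⁽ⁿ⁾ k` for the Fourier matrix of `ϱ ^ n`.

Since `ℓ` is a left eigenvector, inflating a patch by `lam` and then subdividing every tile
replaces a tile of type `c` at position `t` by the patch `ϱ c` at position `lam * t`. Hence
`B⁽ⁿ⁺¹⁾ k = B k * B⁽ⁿ⁾ (lam * k)`, and `B⁽ⁿ⁾ k` is the cocycle product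
`B k * B (lam * k) * ⋯ * B (lam ^ (n - 1) * k)` (`Inflation.IsNaturalLengths.fourierProd_eq`).
The two exponents are therefore related, for every `k`, by `χ_min = log √lam - χ^B`
(`Inflation.IsNaturalLengths.chiMin_eq`), which gives the equivalence.

The bound `χ^B ≤ log √lam` holds almost everywhere because the exponential sums `B⁽ⁿ⁾ᵢⱼ` show
square-root cancellation on average. The tile positions are uniformly separated, so expanding the
square and integrating against the Gaussian `exp (-π k²)` bounds the mean square by a constant
times the number of tiles, uniformly over all patches (`exists_lintegral_norm_sq_sum_exp_le`). The
patch `ϱ ^ n j` has length `lam ^ n * ℓ j`, hence `O(lam ^ n)` tiles. After division by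
`(n + 1) ^ 2 * lam ^ n` the mean squares are summable in `n`, so for almost every `k` one gets
`‖B⁽ⁿ⁾ᵢⱼ k‖ ≤ K * (n + 1) * √lam ^ n` for all `n`, with `K` depending on `k`
(`Inflation.IsNaturalLengths.ae_norm_fourierMatrix_le`).
-/

/-! ### Mean squares of exponential sums and growth rates -/

/-- The mean square of an exponential sum with `δ`-separated frequencies, with respect to a
Gaussian weight, is at most a constant times the number of frequencies, and the constant depends
only on `δ`. The frequencies are indexed so that the separation grows linearly with the index
distance. -/
theorem exists_lintegral_norm_sq_sum_exp_le {δ : ℝ} (hδ : 0 < δ) :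
    ∃ C : ℝ, 0 ≤ C ∧ ∀ (s : Finset ℕ) (t : ℕ → ℝ),
    (∀ p ∈ s, ∀ q ∈ s, δ * |(p : ℝ) - q| ≤ |t p - t q|) →
    ∫⁻ k : ℝ, ENNReal.ofReal (‖∑ p ∈ s, Complex.exp (2 * Real.pi * Complex.I * t p * k)‖ ^ 2 *
      Real.exp (-Real.pi * k ^ 2)) ≤ ENNReal.ofReal (C * s.card) := by
  have hsum : Summable fun d : ℤ => Real.exp (-Real.pi * (δ * d) ^ 2) := by
    have hr : Summable fun n : ℕ => Real.exp (-Real.pi * δ ^ 2) ^ n :=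
      summable_geometric_of_lt_one (Real.exp_pos _).le
        (Real.exp_lt_one_iff.2 (by nlinarith [mul_pos Real.pi_pos (pow_pos hδ 2)]))
    have key : ∀ n : ℕ, Real.exp (-Real.pi * (δ * n) ^ 2) ≤ Real.exp (-Real.pi * δ ^ 2) ^ n := by
      intro n
      rw [← Real.exp_nat_mul]
      apply Real.exp_le_exp.2
      have h1 : (n : ℝ) ≤ (n : ℝ) ^ 2 := by exact_mod_cast Nat.le_self_pow two_ne_zero n
      nlinarith [mul_le_mul_of_nonneg_left h1 (mul_pos Real.pi_pos (pow_pos hδ 2)).le]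
    refine Summable.of_nat_of_neg ?_ ?_
    · exact hr.of_nonneg_of_le (fun n => (Real.exp_pos _).le) (fun n => by simpa using key n)
    · exact hr.of_nonneg_of_le (fun n => (Real.exp_pos _).le) (fun n => by simpa using key n)
  -- The constant bounds every row sum of the matrix `exp (-π (t p - t q)²)`.
  refine ⟨∑' d : ℤ, Real.exp (-Real.pi * (δ * d) ^ 2), tsum_nonneg fun d => (Real.exp_pos _).le, ?_⟩
  intro s t ht
  have hint : ∀ u : ℝ, Integrable (fun k : ℝ =>
      Complex.exp (Complex.I * (2 * Real.pi * u : ℝ) * k) *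
      Complex.exp (-(Real.pi : ℂ) * k ^ 2)) := by
    intro u
    have h := integrable_cexp_quadratic' (b := -(Real.pi : ℂ)) (by simpa using Real.pi_pos)
      (Complex.I * (2 * Real.pi * u : ℝ)) 0
    refine h.congr (.of_forall fun k => ?_)
    simp only [← Complex.exp_add]
    ring_nf
  have hval : ∀ u : ℝ, ∫ k : ℝ, Complex.exp (Complex.I * (2 * Real.pi * u : ℝ) * k) *
      Complex.exp (-(Real.pi : ℂ) * k ^ 2) = (Real.exp (-Real.pi * u ^ 2) : ℝ) := by
    intro u
    have hpi : (Real.pi : ℂ) ≠ 0 := by exact_mod_cast Real.pi_ne_zero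
    rw [fourierIntegral_gaussian (by simpa using Real.pi_pos), div_self hpi, Complex.one_cpow,
      one_mul]
    push_cast
    congr 1
    field_simp
    ring
  have hexp : ∀ k : ℝ, ((‖∑ p ∈ s, Complex.exp (2 * Real.pi * Complex.I * t p * k)‖ ^ 2 *
      Real.exp (-Real.pi * k ^ 2) : ℝ) : ℂ) = ∑ p ∈ s, ∑ q ∈ s,
        Complex.exp (Complex.I * (2 * Real.pi * (t p - t q) : ℝ) * k) *
          Complex.exp (-(Real.pi : ℂ) * k ^ 2) := by
    intro k
    push_cast
    rw [← Complex.mul_conj', map_sum, Finset.sum_mul_sum, Finset.sum_mul]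
    refine Finset.sum_congr rfl fun p _ => ?_
    rw [Finset.sum_mul]
    refine Finset.sum_congr rfl fun q _ => ?_
    rw [← Complex.exp_conj, ← Complex.exp_add]
    congr 2
    simp [Complex.conj_ofNat]
    ring
  have hintC : Integrable (fun k : ℝ =>
      ((‖∑ p ∈ s, Complex.exp (2 * Real.pi * Complex.I * t p * k)‖ ^ 2 *
      Real.exp (-Real.pi * k ^ 2) : ℝ) : ℂ)) := by
    simp_rw [hexp]
    exact integrable_finsetSum _ fun p _ => integrable_finsetSum _ fun q _ => hint _
  have hintR : Integrable (fun k : ℝ =>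
      ‖∑ p ∈ s, Complex.exp (2 * Real.pi * Complex.I * t p * k)‖ ^ 2 *
      Real.exp (-Real.pi * k ^ 2)) := by
    simpa only [Complex.ofReal_re, RCLike.re_to_complex] using hintC.re
  rw [← ofReal_integral_eq_lintegral_ofReal hintR (.of_forall fun k => by positivity)]
  apply ENNReal.ofReal_le_ofReal
  have hI : ∫ k : ℝ, ‖∑ p ∈ s, Complex.exp (2 * Real.pi * Complex.I * t p * k)‖ ^ 2 *
      Real.exp (-Real.pi * k ^ 2) = ∑ p ∈ s, ∑ q ∈ s, Real.exp (-Real.pi * (t p - t q) ^ 2) := by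
    apply Complex.ofReal_injective
    rw [← integral_complex_ofReal]
    simp_rw [hexp]
    rw [integral_finsetSum _ fun p _ => integrable_finsetSum _ fun q _ => hint _]
    simp_rw [integral_finsetSum _ fun q _ => hint _, hval]
    push_cast
    rfl
  rw [hI, mul_comm, ← nsmul_eq_mul]
  refine Finset.sum_le_card_nsmul _ _ _ fun p hp => ?_
  calc ∑ q ∈ s, Real.exp (-Real.pi * (t p - t q) ^ 2)
      ≤ ∑ q ∈ s, Real.exp (-Real.pi * (δ * ((p - q : ℤ) : ℝ)) ^ 2) := by
        refine Finset.sum_le_sum fun q hq => Real.exp_le_exp.2 ?_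
        have h := ht p hp q hq
        have h2 : (δ * |(p : ℝ) - q|) ^ 2 ≤ |t p - t q| ^ 2 := by gcongr
        rw [mul_pow, sq_abs, sq_abs, ← mul_pow] at h2
        push_cast
        nlinarith [mul_le_mul_of_nonneg_left h2 Real.pi_pos.le]
    _ = ∑ d ∈ s.image (fun q : ℕ => (p - q : ℤ)), Real.exp (-Real.pi * (δ * d) ^ 2) := by
        rw [Finset.sum_image]
        intro a _ b _ hab
        simpa using hab
    _ ≤ _ := hsum.sum_le_tsum _ fun d _ => (Real.exp_pos _).le

/-- A Borel-Cantelli argument: integrals growing like `lam ^ n` bound the functions themselves, at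
almost every point, at the cost of the factor `(n + 1) ^ 2`, whose inverse is summable. -/
theorem ae_le_mul_of_lintegral_le {f : ℕ → ℝ → ℝ} (hf : ∀ n, Measurable (f n)) {C lam : ℝ}
    (hlam : 0 < lam) (h : ∀ n, ∫⁻ k, ENNReal.ofReal (f n k) ≤ ENNReal.ofReal (C * lam ^ n)) :
    ∀ᵐ k : ℝ, ∃ K : ℝ, ∀ n, f n k ≤ K * ((n + 1) ^ 2 * lam ^ n) := by
  have hs : Summable fun n : ℕ => C * (1 / ((n : ℝ) + 1) ^ 2) := by
    refine Summable.mul_left _ ?_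
    simpa using (summable_nat_add_iff 1).2 (Real.summable_one_div_nat_pow.2 one_lt_two)
  have hfin : ∫⁻ k, ∑' n, ENNReal.ofReal (f n k / ((n + 1) ^ 2 * lam ^ n)) ≠ ⊤ := by
    rw [lintegral_tsum fun n => (((hf n).div_const _).ennreal_ofReal).aemeasurable]
    refine ne_top_of_le_ne_top hs.tsum_ofReal_ne_top (ENNReal.tsum_le_tsum fun n => ?_)
    have hpos : (0 : ℝ) ≤ ((n + 1) ^ 2 * lam ^ n)⁻¹ := by positivity
    simp_rw [div_eq_mul_inv, ENNReal.ofReal_mul' hpos]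
    rw [lintegral_mul_const _ (hf n).ennreal_ofReal]
    refine (mul_le_mul_left (h n) _).trans ?_
    rw [← ENNReal.ofReal_mul' hpos]
    refine ENNReal.ofReal_le_ofReal (le_of_eq ?_)
    field_simp
  filter_upwards [ae_lt_top' (AEMeasurable.tsum fun n =>
    (((hf n).div_const _).ennreal_ofReal).aemeasurable) hfin] with k hk
  refine ⟨(∑' n, ENNReal.ofReal (f n k / ((n + 1) ^ 2 * lam ^ n))).toReal, fun n => ?_⟩
  rw [← div_le_iff₀ (by positivity)]
  refine (ENNReal.ofReal_le_iff_le_toReal hk.ne).1 (ENNReal.le_tsum n)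

theorem limsup_log_le_log_sqrt {u : ℕ → ℝ} {K lam : ℝ} (hlam : 0 < lam)
    (h : ∀ n : ℕ, u n ≤ K * ((n + 1) * Real.sqrt lam ^ n)) :
    limsup (fun n : ℕ => ((1 / (n : ℝ) : ℝ) : EReal) * ENNReal.log (ENNReal.ofReal (u n))) atTop ≤
      ((Real.log (Real.sqrt lam) : ℝ) : EReal) := by
  have hs : 0 < Real.sqrt lam := Real.sqrt_pos.2 hlam
  -- A positive constant is needed for the logarithm to split into a sum.
  set K' := max K 1
  have hK' : 0 < K' := lt_max_of_lt_right one_pos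
  have hlim : Tendsto (fun n : ℕ => (1 / (n : ℝ)) * Real.log (K' * ((n + 1) * Real.sqrt lam ^ n)))
      atTop (nhds (Real.log (Real.sqrt lam))) := by
    have h0 : Tendsto (fun n : ℕ => 1 / (n : ℝ)) atTop (nhds 0) :=
      tendsto_one_div_atTop_nhds_zero_nat
    have h1 : Tendsto (fun n : ℕ => Real.log ((n : ℝ) + 1) / (n : ℝ)) atTop (nhds 0) := by
      have := (Real.tendsto_pow_log_div_mul_add_atTop 1 (-1) 1 one_ne_zero).comp
        ((tendsto_natCast_atTop_atTop (R := ℝ)).atTop_add (tendsto_const_nhds (x := (1 : ℝ))))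
      simpa [Function.comp_def] using this
    have h2 := ((h0.mul_const (Real.log K')).add h1).add_const (Real.log (Real.sqrt lam))
    simp only [zero_mul, zero_add] at h2
    refine h2.congr' ?_
    filter_upwards [eventually_gt_atTop 0] with n hn
    have hn' : (n : ℝ) ≠ 0 := by positivity
    rw [Real.log_mul hK'.ne' (by positivity), Real.log_mul (by positivity) (by positivity),
      Real.log_pow]
    field_simp
    ring
  have hlim' := (continuous_coe_real_ereal.tendsto _).comp hlim
  rw [← hlim'.limsup_eq]
  refine limsup_le_limsup (.of_forall fun n => ?_)
  simp only [Function.comp_apply]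
  have hb : (0 : ℝ) < K' * ((n + 1) * Real.sqrt lam ^ n) := by positivity
  rw [EReal.coe_mul, ← ENNReal.log_ofReal_of_pos hb]
  refine mul_le_mul_of_nonneg_left
    (ENNReal.log_monotone (ENNReal.ofReal_le_ofReal ((h n).trans ?_)))
    (by exact_mod_cast (by positivity : (0 : ℝ) ≤ 1 / n))
  gcongr
  exact le_max_left _ _

theorem Seminorm.le_sum_norm_entry {A : Type*} [Fintype A] [DecidableEq A]
    (N : Seminorm ℂ (Matrix A A ℂ)) (X : Matrix A A ℂ) :
    N X ≤ ∑ i, ∑ j, ‖X i j‖ * N (Matrix.single i j 1) := by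
  have hsum : ∀ (s : Finset A) (g : A → Matrix A A ℂ), N (∑ a ∈ s, g a) ≤ ∑ a ∈ s, N (g a) :=
    Finset.le_sum_of_subadditive N (map_zero N).le (map_add_le_add N)
  conv_lhs => rw [Matrix.matrix_eq_sum_single X]
  refine (hsum _ _).trans (Finset.sum_le_sum fun i _ =>
    (hsum _ _).trans (Finset.sum_le_sum fun j _ => le_of_eq ?_))
  rw [← map_smul_eq_mul]
  simp [Matrix.smul_single]

namespace Inflation

/-! ### Fourier sums of words and the cocycle identity -/

variable {A : Type*} [DecidableEq A]

/-- The Fourier sum over the left endpoints of the tiles of type `i` in the patch spelled by a word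
that starts at `0`. It is defined by recursion on the word, where prepending a tile `a` shifts the
rest by `ℓ a`; `wordFourier_eq_sum` identifies it with the sum over positions. -/
noncomputable def wordFourier (ℓ : A → ℝ) (i : A) (k : ℝ) : List A → ℂ
  | [] => 0
  | a :: w => (if a = i then 1 else 0) +
      Complex.exp (2 * Real.pi * Complex.I * ℓ a * k) * wordFourier ℓ i k w

theorem wordFourier_append (ℓ : A → ℝ) (i : A) (k : ℝ) (u v : List A) :
    wordFourier ℓ i k (u ++ v) = wordFourier ℓ i k u +
      Complex.exp (2 * Real.pi * Complex.I * ((u.map ℓ).sum : ℝ) * k) * wordFourier ℓ i k v := by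
  induction u with
  | nil => simp [wordFourier]
  | cons a u ih =>
    simp only [List.cons_append, wordFourier, ih, List.map_cons, List.sum_cons]
    rw [mul_add, ← mul_assoc, ← Complex.exp_add, ← add_assoc]
    push_cast
    ring_nf

theorem wordFourier_eq_sum (ℓ : A → ℝ) (i : A) (k : ℝ) (w : List A) :
    wordFourier ℓ i k w = ∑ p ∈ (Finset.range w.length).filter (fun p => w[p]? = some i),
      Complex.exp (2 * Real.pi * Complex.I * (((w.take p).map ℓ).sum : ℝ) * k) := by
  induction w with
  | nil => simp [wordFourier]
  | cons a w ih =>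
    rw [wordFourier, ih, Finset.sum_filter, Finset.sum_filter, List.length_cons,
      Finset.sum_range_succ', add_comm]
    congr 1
    · rw [Finset.mul_sum]
      refine Finset.sum_congr rfl fun p _ => ?_
      simp only [List.getElem?_cons_succ, List.take_succ_cons, List.map_cons, List.sum_cons]
      split_ifs
      · rw [← Complex.exp_add]
        push_cast
        ring_nf
      · simp
    · simp

omit [DecidableEq A] in
theorem mul_abs_sub_le_abs_prefix_sub {ℓ : A → ℝ} {δ : ℝ} (hδ : ∀ a, δ ≤ ℓ a) (w : List A) {p q : ℕ}
    (hp : p ≤ w.length) (hq : q ≤ w.length) :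
    δ * |(p : ℝ) - q| ≤ |((w.take p).map ℓ).sum - ((w.take q).map ℓ).sum| := by
  wlog hpq : q ≤ p generalizing p q
  · rw [abs_sub_comm, abs_sub_comm (List.sum _)]
    exact this hq hp (not_le.1 hpq).le
  obtain ⟨d, rfl⟩ := Nat.exists_eq_add_of_le hpq
  rw [List.take_add, List.map_append, List.sum_append]
  have h := List.card_nsmul_le_sum (((w.drop q).take d).map ℓ) δ
    (List.forall_mem_map.2 fun a _ => hδ a)
  rw [List.length_map, List.length_take, List.length_drop, min_eq_left (by omega),
    nsmul_eq_mul] at h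
  push_cast
  rw [add_sub_cancel_left, add_sub_cancel_left, abs_of_nonneg (Nat.cast_nonneg d), mul_comm]
  exact h.trans (le_abs_self _)

/-- Distinct tiles have distinct positions, as tile lengths are positive, so that no term is lost in
passing from indices to the set of positions. -/
theorem fourierMatrix_apply {ℓ : A → ℝ} (hℓ : ∃ δ > 0, ∀ a, δ ≤ ℓ a) (ϱ : A → List A)
    (k : ℝ) (i j : A) :
    fourierMatrix ϱ ℓ k i j = wordFourier ℓ i k (ϱ j) := by
  obtain ⟨δ, hδ0, hδ⟩ := hℓ
  rw [wordFourier_eq_sum, fourierMatrix, Matrix.of_apply, displacements, Finset.sum_image]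
  intro p hp q hq hpq
  simp only [Finset.coe_filter, Finset.mem_range, Set.mem_ofPred_eq] at hp hq hpq
  have h := mul_abs_sub_le_abs_prefix_sub hδ (ϱ j) hp.1.le hq.1.le
  rw [hpq, sub_self, abs_zero] at h
  have h2 : |(p : ℝ) - q| = 0 := le_antisymm (nonpos_of_mul_nonpos_right h hδ0) (abs_nonneg _)
  exact_mod_cast sub_eq_zero.1 (abs_eq_zero.1 h2)

variable [Fintype A]

theorem IsNaturalLengths.exists_pos_le [Nonempty A] {ϱ : A → List A} {lam : ℝ} {ℓ : A → ℝ}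
    (h : IsNaturalLengths ϱ lam ℓ) : ∃ δ > 0, ∀ a, δ ≤ ℓ a := by
  obtain ⟨a, ha⟩ := Finite.exists_min ℓ
  exact ⟨ℓ a, h.1 a, ha⟩

theorem IsNaturalLengths.sum_map {ϱ : A → List A} {lam : ℝ} {ℓ : A → ℝ}
    (h : IsNaturalLengths ϱ lam ℓ) (a : A) : ((ϱ a).map ℓ).sum = lam * ℓ a := by
  have := congrFun h.2 a
  simp only [Matrix.vecMul, dotProduct, substMatrix, Matrix.of_apply, Pi.smul_apply,
    smul_eq_mul] at this
  rw [← this, Finset.sum_list_map_count, Finset.sum_subset (Finset.subset_univ _)]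
  · simp [mul_comm]
  · intro x _ hx
    simp [List.count_eq_zero.2 (by simpa using hx)]

theorem IsNaturalLengths.sum_map_flatMap {ϱ : A → List A} {lam : ℝ} {ℓ : A → ℝ}
    (h : IsNaturalLengths ϱ lam ℓ) (w : List A) :
    ((w.flatMap ϱ).map ℓ).sum = lam * (w.map ℓ).sum := by
  induction w with
  | nil => simp
  | cons a w ih => simp [ih, h.sum_map, mul_add]

theorem IsNaturalLengths.sum_map_substPow {ϱ : A → List A} {lam : ℝ} {ℓ : A → ℝ}
    (h : IsNaturalLengths ϱ lam ℓ) (n : ℕ) (a : A) :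
    ((substPow ϱ n a).map ℓ).sum = lam ^ n * ℓ a := by
  induction n with
  | zero => simp [substPow]
  | succ n ih => rw [substPow, h.sum_map_flatMap, ih]; ring

/-- The inflation multiplier is positive: if it were zero, then `ℓ` would be annihilated by all
powers of the substitution matrix, one of which is strictly positive. -/
theorem IsNaturalLengths.pos [Nonempty A] {ϱ : A → List A} {lam : ℝ} {ℓ : A → ℝ}
    (h : IsNaturalLengths ϱ lam ℓ) (hϱ : (substMatrix ϱ).IsPrimitive) : 0 < lam := by
  obtain ⟨a⟩ := ‹Nonempty A›
  have h0 : 0 ≤ lam * ℓ a := by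
    rw [← h.sum_map]
    exact List.sum_nonneg (List.forall_mem_map.2 fun b _ => (h.1 b).le)
  refine (nonneg_of_mul_nonneg_left h0 (h.1 a)).lt_of_ne' ?_
  rintro rfl
  obtain ⟨p, hp, hpos⟩ := hϱ.2
  obtain ⟨m, rfl⟩ := Nat.exists_eq_succ_of_ne_zero hp.ne'
  have h1 : Matrix.vecMul ℓ (substMatrix ϱ ^ (m + 1)) = 0 := by
    rw [pow_succ', ← Matrix.vecMul_vecMul, h.2, zero_smul, Matrix.zero_vecMul]
  have h2 : 0 < Matrix.vecMul ℓ (substMatrix ϱ ^ (m + 1)) a :=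
    Finset.sum_pos (fun i _ => mul_pos (h.1 i) (hpos i a)) ⟨a, Finset.mem_univ a⟩
  simp [h1] at h2

/-- Inflation: a tile `c` at `t` becomes the patch `ϱ c` at `lam * t`, and the factor `lam` is
absorbed into the frequency. -/
theorem IsNaturalLengths.wordFourier_flatMap {ϱ : A → List A} {lam : ℝ} {ℓ : A → ℝ}
    (h : IsNaturalLengths ϱ lam ℓ) (i : A) (k : ℝ) (w : List A) :
    wordFourier ℓ i k (w.flatMap ϱ) =
      ∑ c, wordFourier ℓ i k (ϱ c) * wordFourier ℓ c (lam * k) w := by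
  induction w with
  | nil => simp [wordFourier]
  | cons a w ih =>
    rw [List.flatMap_cons, wordFourier_append, ih, h.sum_map]
    simp only [wordFourier, mul_add, Finset.sum_add_distrib, Finset.mul_sum]
    congr 1
    · simp
    · refine Finset.sum_congr rfl fun c _ => ?_
      push_cast
      ring_nf

theorem IsNaturalLengths.fourierProd_eq [Nonempty A] {ϱ : A → List A} {lam : ℝ} {ℓ : A → ℝ}
    (h : IsNaturalLengths ϱ lam ℓ) (n : ℕ) (k : ℝ) :
    fourierProd ϱ lam ℓ n k = fourierMatrix (substPow ϱ n) ℓ k := by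
  induction n generalizing k with
  | zero =>
    ext i j
    rw [fourierMatrix_apply h.exists_pos_le]
    simp [fourierProd, substPow, wordFourier, Matrix.one_apply, eq_comm]
  | succ n ih =>
    have h1 : fourierProd ϱ lam ℓ (n + 1) k =
        fourierMatrix ϱ ℓ k * fourierProd ϱ lam ℓ n (lam * k) := by
      simp only [fourierProd, List.range_succ_eq_map, List.map_cons, List.prod_cons, List.map_map]
      simp [Function.comp_def, pow_succ, mul_assoc]
    rw [h1, ih]
    ext i j
    simp only [Matrix.mul_apply, fourierMatrix_apply h.exists_pos_le, substPow,
      h.wordFourier_flatMap]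

theorem IsNaturalLengths.chiMin_eq [Nonempty A] {ϱ : A → List A} {lam : ℝ} {ℓ : A → ℝ}
    (h : IsNaturalLengths ϱ lam ℓ) (N : Seminorm ℂ (Matrix A A ℂ)) (k : ℝ) :
    chiMin N ϱ lam ℓ k = ((Real.log (Real.sqrt lam) : ℝ) : EReal) - chiB N ϱ ℓ k := by
  rw [chiMin, chiB, sub_eq_add_neg, ← EReal.liminf_neg]
  simp only [h.fourierProd_eq, ENNReal.log_inv, Pi.neg_def, mul_neg]

/-! ### Almost everywhere bounds -/

theorem IsNaturalLengths.ae_norm_fourierMatrix_le [Nonempty A] {ϱ : A → List A} {lam : ℝ}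
    {ℓ : A → ℝ} (h : IsNaturalLengths ϱ lam ℓ) (hlam : 0 < lam) (i j : A) :
    ∀ᵐ k : ℝ, ∃ K : ℝ, ∀ n : ℕ,
      ‖fourierMatrix (substPow ϱ n) ℓ k i j‖ ≤ K * ((n + 1) * Real.sqrt lam ^ n) := by
  obtain ⟨δ, hδ0, hδ⟩ := h.exists_pos_le
  obtain ⟨C, hC0, hC⟩ := exists_lintegral_norm_sq_sum_exp_le hδ0
  -- The patch `ϱ ^ n j` has length `lam ^ n * ℓ j`, and each tile has length at least `δ`.
  have hcard : ∀ n, ((substPow ϱ n j).length : ℝ) ≤ lam ^ n * ℓ j / δ := by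
    intro n
    rw [le_div_iff₀ hδ0, ← h.sum_map_substPow]
    simpa using List.card_nsmul_le_sum ((substPow ϱ n j).map ℓ) δ
      (List.forall_mem_map.2 fun a _ => hδ a)
  have hae := ae_le_mul_of_lintegral_le (C := C * (ℓ j / δ)) (lam := lam)
    (f := fun n k => ‖fourierMatrix (substPow ϱ n) ℓ k i j‖ ^ 2 * Real.exp (-Real.pi * k ^ 2))
    (by intro n; simp only [fourierMatrix, Matrix.of_apply]; fun_prop) hlam ?_
  · filter_upwards [hae] with k ⟨K, hK⟩
    -- The Gaussian weight at `k` does not depend on `n`, so it goes into the constant.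
    refine ⟨Real.sqrt (K * Real.exp (Real.pi * k ^ 2)), fun n => ?_⟩
    have hK0 : 0 ≤ K := by simpa using (by positivity : (0 : ℝ) ≤ _).trans (hK 0)
    refine abs_le_of_sq_le_sq' ?_ (by positivity) |>.2
    have h1 := hK n
    rw [neg_mul, Real.exp_neg, ← div_eq_mul_inv, div_le_iff₀ (Real.exp_pos _)] at h1
    rw [mul_pow, mul_pow, Real.sq_sqrt (by positivity), ← pow_mul, mul_comm n, pow_mul,
      Real.sq_sqrt hlam.le]
    linarith
  · intro n
    simp only [fourierMatrix_apply h.exists_pos_le, wordFourier_eq_sum]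
    refine (hC _ _ ?_).trans (ENNReal.ofReal_le_ofReal ?_)
    · intro p hp q hq
      simp only [Finset.mem_filter, Finset.mem_range] at hp hq
      exact mul_abs_sub_le_abs_prefix_sub hδ _ hp.1.le hq.1.le
    · have h1 : (((Finset.range (substPow ϱ n j).length).filter
          fun p => (substPow ϱ n j)[p]? = some i).card : ℝ) ≤ (substPow ϱ n j).length := by
        exact_mod_cast (Finset.card_filter_le _ _).trans_eq (Finset.card_range _)
      calc _ ≤ C * (lam ^ n * ℓ j / δ) := by gcongr; exact h1.trans (hcard n)
        _ = _ := by ring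

theorem IsNaturalLengths.ae_chiB_le [Nonempty A] {ϱ : A → List A} {lam : ℝ} {ℓ : A → ℝ}
    (h : IsNaturalLengths ϱ lam ℓ) (hlam : 0 < lam) (N : Seminorm ℂ (Matrix A A ℂ)) :
    ∀ᵐ k : ℝ, chiB N ϱ ℓ k ≤ ((Real.log (Real.sqrt lam) : ℝ) : EReal) := by
  have hae : ∀ᵐ k : ℝ, ∀ i j, ∃ K : ℝ, ∀ n : ℕ,
      ‖fourierMatrix (substPow ϱ n) ℓ k i j‖ ≤ K * ((n + 1) * Real.sqrt lam ^ n) :=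
    ae_all_iff.2 fun i => ae_all_iff.2 fun j => h.ae_norm_fourierMatrix_le hlam i j
  filter_upwards [hae] with k hk
  choose K hK using hk
  refine limsup_log_le_log_sqrt (K := ∑ i, ∑ j, K i j * N (Matrix.single i j 1)) hlam fun n => ?_
  refine (Seminorm.le_sum_norm_entry N _).trans ?_
  simp only [Finset.sum_mul]
  refine Finset.sum_le_sum fun i _ => Finset.sum_le_sum fun j _ => ?_
  rw [mul_right_comm]
  exact mul_le_mul_of_nonneg_right (hK i j n) (apply_nonneg N _)

end Inflation

theorem theorem3p15 {A : Type*} [Fintype A] [DecidableEq A] [Nonempty A]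
    (ϱ : A → List A) (hϱ : (Inflation.substMatrix ϱ).IsPrimitive)
    (lam : ℝ) (ℓ : A → ℝ) (hℓ : Inflation.IsNaturalLengths ϱ lam ℓ)
    (N : Seminorm ℂ (Matrix A A ℂ)) (hN : ∀ X, N X = 0 → X = 0) :
    (∀ᵐ k : ℝ ∂volume, 0 ≤ Inflation.chiMin N ϱ lam ℓ k) ∧
    (∀ᵐ k : ℝ ∂volume,
      Inflation.chiB N ϱ ℓ k ≤ ((Real.log (Real.sqrt lam) : ℝ) : EReal)) ∧
    (∀ k : ℝ, 0 ≤ Inflation.chiMin N ϱ lam ℓ k ↔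
      Inflation.chiB N ϱ ℓ k ≤ ((Real.log (Real.sqrt lam) : ℝ) : EReal)) := by
  have hiff : ∀ k : ℝ, 0 ≤ Inflation.chiMin N ϱ lam ℓ k ↔
      Inflation.chiB N ϱ ℓ k ≤ ((Real.log (Real.sqrt lam) : ℝ) : EReal) := fun k => by
    rw [hℓ.chiMin_eq, EReal.sub_nonneg (Or.inl (EReal.coe_ne_top _)) (Or.inl (EReal.coe_ne_bot _))]
  have hae := hℓ.ae_chiB_le (hℓ.pos hϱ) N
  exact ⟨hae.mono fun k hk => (hiff k).2 hk, hae, hiff⟩
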